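/- For $r>0$ and $X\subseteq\mathbb{R}^n$ let $E_r(X)=\bigcup_{x\in X}B(r,x)$, where $B(r,x)$ is the open ball of radius $r$ about $x$. Call $X$ resilient to expansion by $r$ if $E_r(X)=\sigma(X)$ for some similarity transformation $\sigma$ of $\mathbb{R}^n$ (a bijection multiplying all distances by a common positive factor), and expansion-resilient if this holds for at least one $r>0$. A supporting half-space of a closed convex set $C$ is a closed half-space containing $C$ whose boundary hyperplane meets the boundary of $C$; the supporting half-spaces of an open convex set are the interiors of the supporting half-spaces of its closure. The distance between a point and a half-space means here the distance between the point and the boundary hyperplane of the half-space. Theorem. Let $X$ be a (possibly unbounded) convex open subset of $\mathbb{R}^n$. Then $X$ is resilient to expansion by some radius $r>0$ if and only if there are $r>0$, $R>r$ and a point $p$ such that all supporting half-spaces of $X$ are at distance $R$ from $p$. More precisely, for every $r>0$, $X$ is resilient to expansion by $r$ if and only if there are $R>0$ and a point $p$ such that all supporting half-spaces of $X$ are at distance $R$ from $p$. Moreover, a nonempty bounded subset of $\mathbb{R}^n$ (not assumed convex or open) is expansion-resilient if and only if it is an open ball of positive radius. -/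

import Mathlib

/-- The expansion `E_r(X)`: the union of the open balls of radius `r` centred at the points
of `X`. -/
def setExpansion {n : ℕ} (r : ℝ) (X : Set (EuclideanSpace ℝ (Fin n))) :
    Set (EuclideanSpace ℝ (Fin n)) :=
  ⋃ x ∈ X, Metric.ball x r

/-- `X` is resilient to expansion by the radius `r`: the expansion `E_r(X)` is the image of `X`
under a similarity transformation (a bijection that scales all distances by a common positive
factor). -/
def ResilientToExpansion {n : ℕ} (r : ℝ) (X : Set (EuclideanSpace ℝ (Fin n))) : Prop :=
  ∃ σ : EuclideanSpace ℝ (Fin n) ≃ᵈ EuclideanSpace ℝ (Fin n), setExpansion r X = σ '' X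

/-- Closed half-spaces `{x | ⟪a, x⟫ ≤ c}` with `a ≠ 0`. -/
def IsClosedHalfSpace {n : ℕ} (H : Set (EuclideanSpace ℝ (Fin n))) : Prop :=
  ∃ (a : EuclideanSpace ℝ (Fin n)) (c : ℝ), a ≠ 0 ∧ H = {x | inner ℝ a x ≤ c}

/-- `H` is a supporting half-space of the closed set `C`: a closed half-space that contains `C`
and whose boundary meets the boundary of `C`. -/
def IsSupportingHalfSpace {n : ℕ} (C H : Set (EuclideanSpace ℝ (Fin n))) : Prop :=
  IsClosedHalfSpace H ∧ C ⊆ H ∧ ∃ x ∈ frontier C, x ∈ frontier H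

/-- The supporting half-spaces of an open set are the interiors of the supporting half-spaces of
its closure. -/
def IsOpenSupportingHalfSpace {n : ℕ} (X H : Set (EuclideanSpace ℝ (Fin n))) : Prop :=
  ∃ H' : Set (EuclideanSpace ℝ (Fin n)), IsSupportingHalfSpace (closure X) H' ∧ H = interior H'

/-- The boundaries of all supporting half-spaces of the open set `X` lie at the common
distance `R` from the point `p`. -/
def SupportsAtDistance {n : ℕ} (X : Set (EuclideanSpace ℝ (Fin n)))
    (p : EuclideanSpace ℝ (Fin n)) (R : ℝ) : Prop :=
  ∀ H : Set (EuclideanSpace ℝ (Fin n)), IsOpenSupportingHalfSpace X H →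
    Metric.infDist p (frontier H) = R

/-! Let h(a) be the support function of X, measured from p, in the unit direction a. Expansion adds
r to h. A similarity has normal form x ↦ p + c U(x - p) + b with U b = b and c = 1 or b = 0, so
resilience reads h(a) + r = c h(U⁻¹a) + ⟪a, b⟫.

If c ≠ 1, the fixed value is R = r/(c - 1), and h - R is divided by c along an orbit of U⁻¹. A
nonempty X bounds h below, which excludes h < R; recurrence of isometry orbits excludes h > R (for c
< 1, run the orbit the other way). So h = R wherever it is finite. If c = 1, h drifts linearly along
orbits unless ⟪a, b⟫ = r, and this leaves at most one outer normal.

Conversely, suppose all supporting hyperplanes are at distance R from p. Either p is on the inner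
side of all of them, and the homothety about p of ratio 1 + r/R realises the expansion, or one of
them separates p from X. In that case a connectedness argument
(`isOuterNormal_unique_of_separating`) leaves a single normal, and p can be moved inside.

For bounded X, a similarity with c ≤ 1 would force arbitrarily large balls into X. Hence c > 1, and
iterating σ⁻¹ squeezes X between balls whose radii tend to R. -/

open Set Filter Topology Metric
open scoped RealInnerProductSpace

/-! ### Outer normals, metric projections, and moving p inside -/

section InnerProductSpace

variable {E : Type*} [NormedAddCommGroup E] [InnerProductSpace ℝ E]

/-- `a` is a unit outer normal of `X` at the point `y` of its closure. -/
def IsOuterNormal (X : Set E) (a y : E) : Prop :=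
  ‖a‖ = 1 ∧ y ∈ closure X ∧ ∀ x ∈ closure X, ⟪a, x⟫ ≤ ⟪a, y⟫

theorem inner_le_of_mem_closure {X : Set E} {a : E} {t : ℝ} (h : ∀ x ∈ X, ⟪a, x⟫ ≤ t) :
    ∀ x ∈ closure X, ⟪a, x⟫ ≤ t := by
  have hc : IsClosed {x : E | ⟪a, x⟫ ≤ t} := isClosed_le (by fun_prop) continuous_const
  exact fun x hx => closure_minimal (fun y hy => h y hy) hc hx

theorem inner_lt_of_isOpen {X : Set E} (hX : IsOpen X) {a : E} (ha : ‖a‖ = 1) {t : ℝ}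
    (h : ∀ x ∈ X, ⟪a, x⟫ ≤ t) {x : E} (hx : x ∈ X) : ⟪a, x⟫ < t := by
  obtain ⟨ε, hε, hb⟩ := Metric.isOpen_iff.1 hX x hx
  have h1 : x + (ε / 2) • a ∈ X := by
    apply hb
    rw [mem_ball, dist_eq_norm, add_sub_cancel_left, norm_smul, ha, Real.norm_eq_abs,
      abs_of_pos (by positivity)]
    linarith
  have h2 := h _ h1
  rw [inner_add_right, inner_smul_right, real_inner_self_eq_norm_sq, ha] at h2
  linarith

theorem IsOuterNormal.inner_lt {X : Set E} (hX : IsOpen X) {a y x : E} (h : IsOuterNormal X a y)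
    (hx : x ∈ X) : ⟪a, x⟫ < ⟪a, y⟫ :=
  inner_lt_of_isOpen hX h.1 (fun z hz => h.2.2 z (subset_closure hz)) hx

theorem interior_setOf_inner_le {a : E} (ha : a ≠ 0) (c : ℝ) [CompleteSpace E] :
    interior {x : E | ⟪a, x⟫ ≤ c} = {x | ⟪a, x⟫ < c} := by
  have hs : Function.Surjective (innerSL ℝ a) := fun t =>
    ⟨(t / ⟪a, a⟫) • a, by
      have : ⟪a, a⟫ ≠ 0 := inner_self_ne_zero.2 ha
      rw [innerSL_apply_apply, inner_smul_right]; field_simp⟩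
  have := (innerSL ℝ a).interior_preimage hs (Iic c)
  rw [interior_Iic] at this
  exact this

theorem frontier_setOf_inner_le {a : E} (ha : a ≠ 0) (c : ℝ) [CompleteSpace E] :
    frontier {x : E | ⟪a, x⟫ ≤ c} = {x | ⟪a, x⟫ = c} := by
  have hc : IsClosed {x : E | ⟪a, x⟫ ≤ c} := isClosed_le (by fun_prop) continuous_const
  rw [hc.frontier_eq, interior_setOf_inner_le ha]
  ext x
  simp only [Set.mem_sdiff, mem_ofPred_eq, not_lt]
  exact le_antisymm_iff.symm

theorem frontier_setOf_inner_lt {a : E} (ha : a ≠ 0) (c : ℝ) [CompleteSpace E] :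
    frontier {x : E | ⟪a, x⟫ < c} = {x | ⟪a, x⟫ = c} := by
  have hs : Function.Surjective (innerSL ℝ a) := fun t =>
    ⟨(t / ⟪a, a⟫) • a, by
      have : ⟪a, a⟫ ≠ 0 := inner_self_ne_zero.2 ha
      rw [innerSL_apply_apply, inner_smul_right]; field_simp⟩
  have := (innerSL ℝ a).frontier_preimage hs (Iio c)
  rw [frontier_Iio] at this
  exact this

theorem infDist_hyperplane {a : E} (ha : ‖a‖ = 1) (c : ℝ) (p : E) :
    infDist p {x | ⟪a, x⟫ = c} = |⟪a, p⟫ - c| := by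
  have haa : ⟪a, a⟫ = 1 := by rw [real_inner_self_eq_norm_sq, ha]; norm_num
  have hm : p - (⟪a, p⟫ - c) • a ∈ {x | ⟪a, x⟫ = c} := by
    simp [inner_sub_right, inner_smul_right, ha]
  apply le_antisymm
  · refine (infDist_le_dist_of_mem hm).trans_eq ?_
    rw [dist_eq_norm, sub_sub_cancel, norm_smul, ha, mul_one, Real.norm_eq_abs]
  · rw [le_infDist ⟨_, hm⟩]
    intro y hy
    have hy' : ⟪a, y⟫ = c := hy
    rw [← hy', ← inner_sub_right, dist_eq_norm]
    simpa [ha] using abs_real_inner_le_norm a (p - y)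

/-- A choice of metric projections onto the closure of a nonempty convex set. -/
theorem exists_projection [CompleteSpace E] {X : Set E} (hne : X.Nonempty) (hX : Convex ℝ X) :
    ∃ π : E → E, ∀ u, π u ∈ closure X ∧ ∀ w ∈ closure X, ⟪u - π u, w - π u⟫ ≤ 0 := by
  have h : ∀ u, ∃ v ∈ closure X, ∀ w ∈ closure X, ⟪u - v, w - v⟫ ≤ 0 := fun u => by
    obtain ⟨v, hv, h⟩ := exists_norm_eq_iInf_of_complete_convex hne.closure
      isClosed_closure.isComplete hX.closure u
    exact ⟨v, hv, (norm_eq_iInf_iff_real_inner_le_zero hX.closure hv).1 h⟩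
  choose π h1 h2 using h
  exact ⟨π, fun u => ⟨h1 u, h2 u⟩⟩

/-- Adding the variational inequalities at u and v gives ‖πu - πv‖² ≤ ⟪u - v, πu - πv⟫;
Cauchy–Schwarz then makes π 1-Lipschitz. -/
theorem continuous_of_projection {X : Set E} {π : E → E}
    (hπ : ∀ u, π u ∈ closure X ∧ ∀ w ∈ closure X, ⟪u - π u, w - π u⟫ ≤ 0) : Continuous π := by
  have : LipschitzWith 1 π := LipschitzWith.of_dist_le_mul fun u v => by
    rw [NNReal.coe_one, one_mul, dist_eq_norm, dist_eq_norm]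
    have h1 := (hπ u).2 _ (hπ v).1
    have h2 := (hπ v).2 _ (hπ u).1
    have h3 : ‖π u - π v‖ ^ 2 ≤ ⟪u - v, π u - π v⟫ := by
      rw [← real_inner_self_eq_norm_sq]
      have e : ⟪u - v, π u - π v⟫ - ⟪π u - π v, π u - π v⟫
          = -(⟪u - π u, π v - π u⟫ + ⟪v - π v, π u - π v⟫) := by
        simp only [inner_sub_left, inner_sub_right]; ring
      linarith
    have h4 := real_inner_le_norm (u - v) (π u - π v)
    by_contra! h5
    have h6 : 0 < ‖π u - π v‖ := (norm_nonneg _).trans_lt h5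
    nlinarith
  exact this.continuous

theorem norm_normalize {v : E} (hv : v ≠ 0) : ‖‖v‖⁻¹ • v‖ = 1 := by
  rw [norm_smul, norm_inv, norm_norm, inv_mul_cancel₀ (norm_ne_zero_iff.2 hv)]

theorem isOuterNormal_of_projection {X : Set E} {π : E → E}
    (hπ : ∀ u, π u ∈ closure X ∧ ∀ w ∈ closure X, ⟪u - π u, w - π u⟫ ≤ 0) {u : E}
    (hu : u ∉ closure X) : IsOuterNormal X (‖u - π u‖⁻¹ • (u - π u)) (π u) := by
  have hne : u - π u ≠ 0 := fun h => hu (sub_eq_zero.1 h ▸ (hπ u).1)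
  refine ⟨norm_normalize hne, (hπ u).1, fun x hx => ?_⟩
  rw [real_inner_smul_left, real_inner_smul_left]
  have := (hπ u).2 x hx
  rw [inner_sub_right] at this
  exact mul_le_mul_of_nonneg_left (by linarith) (by positivity)

/-- Hahn–Banach handles boundary points and the projection handles exterior ones. Thus X is the
intersection of its open supporting half-spaces. -/
theorem exists_isOuterNormal_of_notMem [CompleteSpace E] {X : Set E} (hX : Convex ℝ X)
    (ho : IsOpen X) (hne : X.Nonempty) {w : E} (hw : w ∉ X) :
    ∃ a y, IsOuterNormal X a y ∧ ⟪a, y⟫ ≤ ⟪a, w⟫ := by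
  by_cases hwc : w ∈ closure X
  · obtain ⟨f, hf⟩ := geometric_hahn_banach_open_point hX ho hw
    obtain ⟨v, rfl⟩ := (InnerProductSpace.toDual ℝ E).surjective f
    simp only [InnerProductSpace.toDual_apply_apply] at hf
    have hv : v ≠ 0 := by
      rintro rfl
      obtain ⟨x, hx⟩ := hne
      simpa using hf x hx
    refine ⟨‖v‖⁻¹ • v, w, ⟨norm_normalize hv, hwc, inner_le_of_mem_closure fun x hx => ?_⟩, le_rfl⟩
    rw [real_inner_smul_left, real_inner_smul_left]
    exact mul_le_mul_of_nonneg_left (hf x hx).le (by positivity)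
  · obtain ⟨π, hπ⟩ := exists_projection hne hX
    refine ⟨_, _, isOuterNormal_of_projection hπ hwc, ?_⟩
    have h : 0 ≤ ⟪‖w - π w‖⁻¹ • (w - π w), w - π w⟫ := by
      rw [real_inner_smul_left, real_inner_self_eq_norm_sq]; positivity
    rw [inner_sub_right] at h
    linarith

theorem eq_smul_of_norm_le_inner {a v : E} {R : ℝ} (ha : ‖a‖ = 1) (hv : ‖v‖ = R)
    (h : R ≤ ⟪a, v⟫) : v = R • a := by
  have h0 : 0 ≤ R := hv ▸ norm_nonneg v
  have : ‖v - R • a‖ ^ 2 ≤ 0 := by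
    rw [norm_sub_sq_real, hv, norm_smul, ha, inner_smul_right, real_inner_comm, Real.norm_eq_abs,
      mul_one, sq_abs]
    nlinarith
  exact sub_eq_zero.1
    (norm_eq_zero.1 (pow_eq_zero_iff two_ne_zero |>.1 (le_antisymm this (by positivity))))

/-- If the hyperplanes orthogonal to the outer normals lie at distance `R` from `p` and one of them
separates `p` from `X`, then `X` has no other outer normal. -/
theorem isOuterNormal_unique_of_separating [CompleteSpace E] {X : Set E} (hX : Convex ℝ X)
    (ho : IsOpen X) (hne : X.Nonempty) {p : E} {R : ℝ} (hR : 0 < R)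
    (h : ∀ a y, IsOuterNormal X a y → |⟪a, p⟫ - ⟪a, y⟫| = R) {a₁ y₁ a y : E}
    (h₁ : IsOuterNormal X a₁ y₁) (hp : ⟪a₁, p⟫ - ⟪a₁, y₁⟫ = R) (ha : IsOuterNormal X a y) :
    a = a₁ := by
  obtain ⟨π, hπ⟩ := exists_projection hne hX
  have hpc : p ∉ closure X := fun hc => by have := h₁.2.2 p hc; linarith
  have hpne : p - π p ≠ 0 := fun h => hpc (sub_eq_zero.1 h ▸ (hπ p).1)
  have hpR : ‖p - π p‖ = R := by
    have := h _ _ (isOuterNormal_of_projection hπ hpc)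
    rw [← inner_sub_right, real_inner_smul_left, real_inner_self_eq_norm_sq, pow_two,
      inv_mul_cancel_left₀ (norm_ne_zero_iff.2 hpne), abs_of_nonneg (norm_nonneg _)] at this
    exact this
  -- Equality in Cauchy–Schwarz: every separating normal is the direction from π p to p.
  have key : ∀ b z, IsOuterNormal X b z → ⟪b, p⟫ - ⟪b, z⟫ = R → p - π p = R • b := by
    intro b z hb hz
    refine eq_smul_of_norm_le_inner hb.1 hpR ?_
    have := hb.2.2 _ (hπ p).1
    rw [inner_sub_right]; linarith
  rcases (abs_eq hR.le).1 (h a y ha) with h2 | h2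
  · exact smul_right_injective E hR.ne' ((key _ _ ha h2).symm.trans (key _ _ h₁ hp))
  exfalso
  have hneg : a ≠ -a₁ := by
    rintro rfl
    obtain ⟨x, hx⟩ := hne
    have e1 := h₁.inner_lt ho hx
    have e2 := ha.inner_lt ho hx
    simp only [inner_neg_left] at e2 h2
    linarith
  have hs : 0 < 1 + ⟪a₁, a⟫ := by
    by_contra! hle
    refine hneg ?_
    have := eq_smul_of_norm_le_inner (a := a₁) (v := -a) (R := 1) h₁.1 (by rw [norm_neg, ha.1])
      (by rw [inner_neg_right]; linarith)
    rw [one_smul] at this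
    rw [← this, neg_neg]
  have haa : ⟪a, a⟫ = 1 := by rw [real_inner_self_eq_norm_sq, ha.1]; norm_num
  have haa₁ : ⟪a₁, a₁⟫ = 1 := by rw [real_inner_self_eq_norm_sq, h₁.1]; norm_num
  -- Since a ≠ -a₁, the two outer half-spaces meet: t • (a + a₁) lies beyond both hyperplanes. Their
  -- union is therefore connected, and it avoids the closure of X.
  set t : ℝ := (|⟪a, y⟫| + |⟪a₁, y₁⟫| + 1) / (1 + ⟪a₁, a⟫) with ht
  have htm : t * (1 + ⟪a₁, a⟫) = |⟪a, y⟫| + |⟪a₁, y₁⟫| + 1 := by rw [ht]; field_simp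
  have hV : IsPreconnected ({x : E | ⟪a₁, y₁⟫ < ⟪a₁, x⟫} ∪ {x : E | ⟪a, y⟫ < ⟪a, x⟫}) := by
    refine IsPreconnected.union (t • (a + a₁)) ?_ ?_ ?_ ?_
    · have e : ⟪a₁, t • (a + a₁)⟫ = t * (1 + ⟪a₁, a⟫) := by
        rw [inner_smul_right, inner_add_right, haa₁]; ring
      rw [mem_ofPred_eq, e, htm]
      linarith [le_abs_self ⟪a₁, y₁⟫, abs_nonneg ⟪a, y⟫]
    · have e : ⟪a, t • (a + a₁)⟫ = t * (1 + ⟪a₁, a⟫) := by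
        rw [inner_smul_right, inner_add_right, haa, real_inner_comm]
      rw [mem_ofPred_eq, e, htm]
      linarith [le_abs_self ⟪a, y⟫, abs_nonneg ⟪a₁, y₁⟫]
    · exact (convex_halfSpace_gt (innerSL ℝ a₁).isLinear _).isPreconnected
    · exact (convex_halfSpace_gt (innerSL ℝ a).isLinear _).isPreconnected
  have hπc := continuous_of_projection hπ
  have hφ : Continuous fun z => ⟪z - π z, p - π z⟫ := by fun_prop
  have hza : π (y + a) = y := by
    have e1 := (hπ (y + a)).2 y ha.2.1
    have e2 := ha.2.2 _ (hπ (y + a)).1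
    have e3 : y + a - π (y + a) = (y - π (y + a)) + a := by abel
    rw [e3, inner_add_left, real_inner_self_eq_norm_sq, inner_sub_right] at e1
    have e4 : ‖y - π (y + a)‖ ^ 2 = 0 := le_antisymm (by linarith) (by positivity)
    exact (sub_eq_zero.1 (norm_eq_zero.1 (pow_eq_zero_iff two_ne_zero |>.1 e4))).symm
  have hmem : (0 : ℝ) ∈ Icc (⟪(y + a) - π (y + a), p - π (y + a)⟫) (⟪p - π p, p - π p⟫) := by
    refine ⟨?_, real_inner_self_nonneg⟩
    rw [hza, add_sub_cancel_left, inner_sub_right]; linarith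
  -- The function ⟪z - π z, p - π z⟫ is negative at y + a and positive at p. At a zero, the
  -- supporting hyperplane at π z passes through p, so its distance is 0 rather than R.
  obtain ⟨z, hz, hz0⟩ := hV.intermediate_value (a := y + a) (b := p)
    (Or.inr (by rw [mem_ofPred_eq, inner_add_right, haa]; linarith))
    (Or.inl (by rw [mem_ofPred_eq]; linarith)) hφ.continuousOn hmem
  have hzc : z ∉ closure X := by
    intro hc
    rcases hz with hz | hz
    · exact absurd (h₁.2.2 z hc) (not_le.2 hz)
    · exact absurd (ha.2.2 z hc) (not_le.2 hz)
  have h3 := h _ _ (isOuterNormal_of_projection hπ hzc)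
  simp only at hz0
  rw [← inner_sub_right, real_inner_smul_left, hz0, mul_zero, abs_zero] at h3
  exact hR.ne h3

/-- A single normal means at most one supporting hyperplane, so a point one unit inside it serves.
-/
theorem exists_forall_isOuterNormal_of_unique {X : Set E}
    (h : ∀ a y a' y', IsOuterNormal X a y → IsOuterNormal X a' y' → a' = a) :
    ∃ (R : ℝ) (p : E), 0 < R ∧ ∀ a y, IsOuterNormal X a y → ⟪a, y⟫ - ⟪a, p⟫ = R := by
  by_cases hex : ∃ a y, IsOuterNormal X a y
  · obtain ⟨a, y, ha⟩ := hex
    refine ⟨1, y - a, one_pos, fun a' y' ha' => ?_⟩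
    obtain rfl := h _ _ _ _ ha ha'
    have := le_antisymm (ha.2.2 _ ha'.2.1) (ha'.2.2 _ ha.2.1)
    rw [this, inner_sub_right, real_inner_self_eq_norm_sq, ha.1]
    ring
  · exact ⟨1, 0, one_pos, fun a y ha => absurd ⟨a, y, ha⟩ hex⟩

theorem exists_forall_isOuterNormal_inner_sub_eq [CompleteSpace E] {X : Set E} (hX : Convex ℝ X)
    (ho : IsOpen X) (hne : X.Nonempty) {p : E} {R : ℝ} (hR : 0 < R)
    (h : ∀ a y, IsOuterNormal X a y → |⟪a, p⟫ - ⟪a, y⟫| = R) :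
    ∃ (S : ℝ) (q : E), 0 < S ∧ ∀ a y, IsOuterNormal X a y → ⟪a, y⟫ - ⟪a, q⟫ = S := by
  by_cases hex : ∃ a₁ y₁, IsOuterNormal X a₁ y₁ ∧ ⟪a₁, p⟫ - ⟪a₁, y₁⟫ = R
  · obtain ⟨a₁, y₁, h₁, hp⟩ := hex
    refine exists_forall_isOuterNormal_of_unique fun a y a' y' ha ha' => ?_
    rw [isOuterNormal_unique_of_separating hX ho hne hR h h₁ hp ha,
      isOuterNormal_unique_of_separating hX ho hne hR h h₁ hp ha']
  · refine ⟨R, p, hR, fun a y ha => ?_⟩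
    rcases (abs_eq hR.le).1 (h a y ha) with h2 | h2
    · exact absurd ⟨a, y, ha, h2⟩ hex
    · linarith

end InnerProductSpace

/-! ### Support bounds along orbits of an isometry -/

section Dilation

variable {E : Type*} [NormedAddCommGroup E] [InnerProductSpace ℝ E]

/-- The bounded orbit has a Cauchy subsequence; cancelling the smaller iterate, an isometry, turns
two close terms into a return near a. -/
theorem mapClusterPt_iterate_linearIsometryEquiv [FiniteDimensional ℝ E] (V : E ≃ₗᵢ[ℝ] E) (a : E) :
    MapClusterPt a atTop fun k => V^[k] a := by
  have hiso : ∀ k, Isometry V^[k] := fun k => by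
    induction k with
    | zero => exact isometry_id
    | succ k ih => rw [Function.iterate_succ]; exact ih.comp V.isometry
  have hz : ∀ k, V^[k] 0 = 0 := fun k => Function.iterate_fixed (map_zero V) k
  rw [mapClusterPt_iff_frequently]
  intro s hs
  obtain ⟨ε, hε, hb⟩ := Metric.mem_nhds_iff.1 hs
  rw [frequently_atTop]
  intro N
  have hbd : ∀ k, V^[k] a ∈ closedBall (0 : E) ‖a‖ := fun k => by
    rw [mem_closedBall]
    have := (hiso k).dist_eq a 0
    rw [hz, dist_zero_right a] at this
    exact this.le
  obtain ⟨l, -, φ, hφ, hl⟩ := tendsto_subseq_of_bounded isBounded_closedBall hbd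
  obtain ⟨M, hM⟩ := Metric.cauchySeq_iff.1 hl.cauchySeq ε hε
  -- This makes the return time at least N.
  have hle : φ M + N ≤ φ (M + N) := by
    clear hM
    induction N with
    | zero => simp
    | succ N ih => have := hφ (show M + N < M + (N + 1) by omega); omega
  refine ⟨φ (M + N) - φ M, by omega, hb ?_⟩
  have h := hM (M + N) (by omega) M le_rfl
  have e : φ (M + N) = φ M + (φ (M + N) - φ M) := by omega
  simp only [Function.comp] at h
  rw [e, Function.iterate_add_apply, (hiso (φ M)).dist_eq] at h
  exact h

/-- The closed half-space with outer normal `a` whose boundary has signed distance `s` from `p`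
contains `X`. -/
def InnerBoundedBy (X : Set E) (p a : E) (s : ℝ) : Prop :=
  ∀ x ∈ X, ⟪a, x - p⟫ ≤ s

theorem InnerBoundedBy.neg_norm_le {X : Set E} {p a x : E} {s : ℝ} (h : InnerBoundedBy X p a s)
    (ha : ‖a‖ = 1) (hx : x ∈ X) : -‖x - p‖ ≤ s := by
  have h1 := (abs_le.1 (abs_real_inner_le_norm a (x - p))).1
  rw [ha, one_mul] at h1
  exact h1.trans (h x hx)

theorem IsOuterNormal.innerBoundedBy {X : Set E} {a y : E} (h : IsOuterNormal X a y) (p : E) :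
    InnerBoundedBy X p a (⟪a, y⟫ - ⟪a, p⟫) := fun x hx => by
  have := h.2.2 x (subset_closure hx)
  rw [inner_sub_right]; linarith

/-- Backwards, s - R is multiplied by c, so a negative excess would tend to -∞ against the lower
bound -‖x₀ - p‖. Forwards, it tends to 0 while the direction returns near a. -/
theorem InnerBoundedBy.le_and_innerBoundedBy_of_scaling [FiniteDimensional ℝ E] {X : Set E} {p x₀ : E} (hx₀ : x₀ ∈ X)
    (V : E ≃ₗᵢ[ℝ] E) {c R : ℝ} (hc : 1 < c)
    (hV : ∀ a g, ‖a‖ = 1 → (InnerBoundedBy X p a (R + g) ↔ InnerBoundedBy X p (V a) (R + g / c)))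
    {a : E} {s : ℝ} (ha : ‖a‖ = 1) (h : InnerBoundedBy X p a s) :
    R ≤ s ∧ InnerBoundedBy X p a R := by
  have hc0 : 0 < c := one_pos.trans hc
  constructor
  · by_contra! hlt
    have hback : ∀ k : ℕ, ∃ b, ‖b‖ = 1 ∧ InnerBoundedBy X p b (R + (s - R) * c ^ k) := fun k => by
      induction k with
      | zero => exact ⟨a, ha, by simpa using h⟩
      | succ k ih =>
        obtain ⟨b, hb, hq⟩ := ih
        have hb' : ‖V.symm b‖ = 1 := by rw [V.symm.norm_map, hb]
        refine ⟨V.symm b, hb', (hV _ _ hb').2 ?_⟩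
        rw [V.apply_symm_apply, pow_succ, ← mul_assoc, mul_div_cancel_right₀ _ hc0.ne']
        exact hq
    obtain ⟨k, hk⟩ := pow_unbounded_of_one_lt ((R + ‖x₀ - p‖) / (R - s)) hc
    obtain ⟨b, hb, hq⟩ := hback k
    have h1 := hq.neg_norm_le hb hx₀
    rw [div_lt_iff₀ (by linarith)] at hk
    linarith
  · have hfwd : ∀ k : ℕ, ‖V^[k] a‖ = 1 ∧ InnerBoundedBy X p (V^[k] a) (R + (s - R) / c ^ k) :=
      fun k => by
        induction k with
        | zero => exact ⟨ha, by simpa using h⟩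
        | succ k ih =>
          rw [Function.iterate_succ_apply', pow_succ, ← div_div]
          exact ⟨by rw [V.norm_map, ih.1], (hV _ _ ih.1).1 ih.2⟩
    intro x hx
    by_contra! hlt
    obtain ⟨m, hm1, hm2⟩ := exists_between hlt
    have h1 : ∃ᶠ k in atTop, m < ⟪V^[k] a, x - p⟫ :=
      (mapClusterPt_iff_frequently.1 (mapClusterPt_iterate_linearIsometryEquiv V a))
        {b | m < ⟪b, x - p⟫} ((isOpen_lt continuous_const (by fun_prop)).mem_nhds hm2)
    have h2 : Tendsto (fun k : ℕ => R + (s - R) / c ^ k) atTop (𝓝 (R + 0)) :=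
      tendsto_const_nhds.add (tendsto_const_nhds.div_atTop (tendsto_pow_atTop_atTop_of_one_lt hc))
    rw [add_zero] at h2
    obtain ⟨k, hk1, hk2⟩ := (h1.and_eventually (h2.eventually_lt_const hm1)).exists
    have := (hfwd k).2 x hx
    linarith

/-- As b is fixed, ⟪a, b⟫ is constant on the orbit and the bound changes by r - ⟪a, b⟫ at each step.
If this is nonzero, one direction of time drives the bound to -∞. -/
theorem InnerBoundedBy.inner_eq_of_translating {X : Set E} {p x₀ b : E} (hx₀ : x₀ ∈ X)
    (V : E ≃ₗᵢ[ℝ] E) (hb : V b = b) {r : ℝ}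
    (hV : ∀ a s, ‖a‖ = 1 → (InnerBoundedBy X p a s ↔ InnerBoundedBy X p (V a) (s + r - ⟪a, b⟫)))
    {a : E} {s : ℝ} (ha : ‖a‖ = 1) (h : InnerBoundedBy X p a s) : ⟪a, b⟫ = r := by
  have hsb : V.symm b = b := by rw [LinearIsometryEquiv.symm_apply_eq, hb]
  have hfwd : ∀ k : ℕ, ∃ a', ‖a'‖ = 1 ∧ ⟪a', b⟫ = ⟪a, b⟫ ∧
      InnerBoundedBy X p a' (s + k * (r - ⟪a, b⟫)) := fun k => by
    induction k with
    | zero => exact ⟨a, ha, rfl, by simpa using h⟩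
    | succ k ih =>
      obtain ⟨a', h1, h2, h3⟩ := ih
      refine ⟨V a', by rw [V.norm_map, h1], ?_, ?_⟩
      · rw [← h2]; conv_lhs => rw [← hb]
        exact V.inner_map_map a' b
      · have := (hV _ _ h1).1 h3
        rw [h2] at this
        convert this using 1
        push_cast; ring
  have hback : ∀ k : ℕ, ∃ a', ‖a'‖ = 1 ∧ ⟪a', b⟫ = ⟪a, b⟫ ∧
      InnerBoundedBy X p a' (s - k * (r - ⟪a, b⟫)) := fun k => by
    induction k with
    | zero => exact ⟨a, ha, rfl, by simpa using h⟩
    | succ k ih =>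
      obtain ⟨a', h1, h2, h3⟩ := ih
      have h1' : ‖V.symm a'‖ = 1 := by rw [V.symm.norm_map, h1]
      have h2' : ⟪V.symm a', b⟫ = ⟪a, b⟫ := by
        rw [← h2]; conv_lhs => rw [← hsb]
        exact V.symm.inner_map_map a' b
      refine ⟨V.symm a', h1', h2', (hV _ _ h1').2 ?_⟩
      rw [V.apply_symm_apply, h2']
      convert h3 using 1
      push_cast; ring
  rcases lt_trichotomy ⟪a, b⟫ r with hlt | heq | hlt
  · obtain ⟨k, hk⟩ := exists_nat_gt ((s + ‖x₀ - p‖) / (r - ⟪a, b⟫))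
    obtain ⟨a', h1, -, h3⟩ := hback k
    have := h3.neg_norm_le h1 hx₀
    rw [div_lt_iff₀ (by linarith)] at hk
    linarith
  · exact heq
  · obtain ⟨k, hk⟩ := exists_nat_gt ((s + ‖x₀ - p‖) / (⟪a, b⟫ - r))
    obtain ⟨a', h1, -, h3⟩ := hfwd k
    have := h3.neg_norm_le h1 hx₀
    rw [div_lt_iff₀ (by linarith)] at hk
    linarith

/-- The normalised sum of two bounded directions is again bounded, which forces ‖a + a'‖ = 2; the
parallelogram law gives a = a'. -/
theorem InnerBoundedBy.unique_of_inner_eq {X : Set E} {p b : E} {r : ℝ} (hr : 0 < r)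
    (h : ∀ a s, ‖a‖ = 1 → InnerBoundedBy X p a s → ⟪a, b⟫ = r) {a a' : E} {s s' : ℝ}
    (ha : ‖a‖ = 1) (hs : InnerBoundedBy X p a s) (ha' : ‖a'‖ = 1) (hs' : InnerBoundedBy X p a' s') :
    a' = a := by
  have h1 := h a s ha hs
  have h2 := h a' s' ha' hs'
  have h3 : ⟪a + a', b⟫ = 2 * r := by rw [inner_add_left]; linarith
  have hne : a + a' ≠ 0 := fun h0 => by rw [h0, inner_zero_left] at h3; linarith
  have hpos : 0 < ‖a + a'‖ := norm_pos_iff.2 hne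
  have h4 := h _ (‖a + a'‖⁻¹ * (s + s')) (norm_normalize hne) fun x hx => by
    rw [real_inner_smul_left, inner_add_left]
    exact mul_le_mul_of_nonneg_left (add_le_add (hs x hx) (hs' x hx)) (by positivity)
  rw [real_inner_smul_left, h3] at h4
  have h5 : ‖a + a'‖ = 2 := by
    field_simp at h4
    linarith
  have h6 := parallelogram_law_with_norm ℝ a a'
  rw [h5, ha, ha'] at h6
  have h7 : ‖a - a'‖ * ‖a - a'‖ = 0 := by linarith
  exact (sub_eq_zero.1 (norm_eq_zero.1 (mul_self_eq_zero.1 h7))).symm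

/-! ### Normal form of similarities -/

theorem DilationEquiv.exists_eq_smul_linearIsometryEquiv_add (σ : E ≃ᵈ E) :
    ∃ (c : ℝ) (U : E ≃ₗᵢ[ℝ] E) (b : E), 0 < c ∧ ∀ x, σ x = c • U x + b := by
  set c : ℝ := (Dilation.ratio σ : ℝ) with hc
  have hc0 : 0 < c := NNReal.coe_pos.2 (Dilation.ratio_pos σ)
  let e : E ≃ E := σ.toEquiv.trans ((Equiv.subRight (σ 0)).trans
    (MulAction.toPerm (Units.mk0 c⁻¹ (inv_ne_zero hc0.ne'))))
  have he : ∀ x, e x = c⁻¹ • (σ x - σ 0) := fun x => rfl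
  have hiso : Isometry e := Isometry.of_dist_eq fun x y => by
    rw [he, he, dist_smul₀, dist_sub_right, Dilation.dist_eq, Real.norm_eq_abs,
      abs_of_pos (inv_pos.2 hc0), ← hc, inv_mul_cancel_left₀ hc0.ne']
  have h0 : IsometryEquiv.mk e hiso 0 = 0 := by
    change e 0 = 0
    rw [he, sub_self, smul_zero]
  refine ⟨c, (IsometryEquiv.mk e hiso).toRealLinearIsometryEquivOfMapZero h0, σ 0, hc0, fun x => ?_⟩
  rw [IsometryEquiv.coe_toRealLinearIsometryEquivOfMapZero]
  change _ = c • e x + _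
  rw [he, smul_inv_smul₀ hc0.ne', sub_add_cancel]

/-- Normal form of a similarity: a spiral similarity with a fixed point, or a rotation about a
point followed by a translation along an invariant vector. -/
theorem DilationEquiv.exists_normal_form [FiniteDimensional ℝ E] (σ : E ≃ᵈ E) :
    ∃ (c : ℝ) (U : E ≃ₗᵢ[ℝ] E) (p b : E), 0 < c ∧ (∀ x, σ x = p + c • U (x - p) + b) ∧ U b = b ∧
      (c = 1 ∨ b = 0) := by
  obtain ⟨c, U, b', hc, hσ⟩ := σ.exists_eq_smul_linearIsometryEquiv_add
  let T : E →ₗ[ℝ] E := LinearMap.id - c • U.toLinearEquiv.toLinearMap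
  have hT : ∀ x, T x = x - c • U x := fun x => rfl
  obtain ⟨y, ⟨p, rfl⟩, w, hw, hb'⟩ := (LinearMap.range T).exists_add_mem_mem_orthogonal b'
  have horth : ∀ v, ⟪w, v⟫ = c * ⟪w, U v⟫ := fun v => by
    have := (Submodule.mem_orthogonal' _ _).1 hw (T v) (LinearMap.mem_range_self T v)
    rw [hT, inner_sub_right, inner_smul_right] at this
    linarith
  -- Taking v = w and v = U⁻¹w in `horth`, Cauchy–Schwarz gives ‖w‖² ≤ c‖w‖² and c‖w‖² ≤ ‖w‖². So c
  -- = 1 or w = 0; for c = 1, the equality case is U w = w.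
  have hfin : U w = w ∧ (c = 1 ∨ w = 0) := by
    have h1 := horth w
    have h2 := horth (U.symm w)
    have h3 := real_inner_le_norm w (U w)
    have h4 := real_inner_le_norm w (U.symm w)
    rw [U.apply_symm_apply] at h2
    rw [real_inner_self_eq_norm_sq] at h1 h2
    rw [U.norm_map] at h3
    rw [U.symm.norm_map] at h4
    rcases eq_or_ne c 1 with rfl | hne
    · refine ⟨?_, Or.inl rfl⟩
      have : ‖U w - w‖ ^ 2 = 0 := by
        rw [norm_sub_sq_real, U.norm_map, real_inner_comm]
        linarith
      exact sub_eq_zero.1 (norm_eq_zero.1 (pow_eq_zero_iff two_ne_zero |>.1 this))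
    · have h0 : w = 0 := by
        by_contra hw0
        have hpos : 0 < ‖w‖ := norm_pos_iff.2 hw0
        have hsq : 0 < ‖w‖ * ‖w‖ := mul_pos hpos hpos
        have h5 := mul_le_mul_of_nonneg_left h3 hc.le
        rcases lt_or_gt_of_ne hne with hlt | hlt
        · have := mul_lt_mul_of_pos_right hlt hsq
          rw [pow_two] at h1
          linarith
        · have := mul_lt_mul_of_pos_right hlt hsq
          rw [pow_two] at h2
          linarith
      exact ⟨by rw [h0, map_zero], Or.inr h0⟩
  refine ⟨c, U, p, w, hc, fun x => ?_, hfin⟩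
  rw [hσ, hb', hT, map_sub, smul_sub]
  abel

end Dilation

/-! ### Expansions of convex open sets -/

section Expansion

variable {n : ℕ}

theorem setExpansion_eq_thickening (r : ℝ) (X : Set (EuclideanSpace ℝ (Fin n))) :
    setExpansion r X = thickening r X :=
  thickening_eq_biUnion_ball.symm

theorem isOpenSupportingHalfSpace_iff {X H : Set (EuclideanSpace ℝ (Fin n))} :
    IsOpenSupportingHalfSpace X H ↔
      ∃ a y, IsOuterNormal X a y ∧ H = {x | ⟪a, x⟫ < ⟪a, y⟫} := by
  constructor
  · rintro ⟨H', ⟨⟨a, c, ha, rfl⟩, hsub, y, hyX, hyH⟩, rfl⟩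
    rw [frontier_setOf_inner_le ha] at hyH
    obtain rfl : ⟪a, y⟫ = c := hyH
    have hpos : 0 < ‖a‖⁻¹ := inv_pos.2 (norm_pos_iff.2 ha)
    refine ⟨‖a‖⁻¹ • a, y, ⟨norm_normalize ha, isClosed_closure.frontier_subset hyX,
      fun x hx => ?_⟩, ?_⟩
    · rw [real_inner_smul_left, real_inner_smul_left]
      exact mul_le_mul_of_nonneg_left (hsub hx) hpos.le
    · rw [interior_setOf_inner_le ha]
      ext x
      simp only [mem_ofPred_eq, real_inner_smul_left]
      exact (mul_lt_mul_iff_right₀ hpos).symm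
  · rintro ⟨a, y, h, rfl⟩
    have ha : a ≠ 0 := norm_ne_zero_iff.1 (by rw [h.1]; exact one_ne_zero)
    refine ⟨{x | ⟪a, x⟫ ≤ ⟪a, y⟫}, ⟨⟨a, _, ha, rfl⟩, h.2.2, y, ?_, ?_⟩, ?_⟩
    · refine ⟨subset_closure h.2.1, fun hy => ?_⟩
      exact lt_irrefl _ (inner_lt_of_isOpen isOpen_interior h.1
        (fun x hx => h.2.2 x (interior_subset hx)) hy)
    · rw [frontier_setOf_inner_le ha]
      exact rfl
    · rw [interior_setOf_inner_le ha]

theorem supportsAtDistance_iff {X : Set (EuclideanSpace ℝ (Fin n))}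
    {p : EuclideanSpace ℝ (Fin n)} {R : ℝ} :
    SupportsAtDistance X p R ↔ ∀ a y, IsOuterNormal X a y → |⟪a, p⟫ - ⟪a, y⟫| = R := by
  have key : ∀ a y, IsOuterNormal X a y →
      infDist p (frontier {x | ⟪a, x⟫ < ⟪a, y⟫}) = |⟪a, p⟫ - ⟪a, y⟫| := fun a y h => by
    rw [frontier_setOf_inner_lt (norm_ne_zero_iff.1 (by rw [h.1]; exact one_ne_zero)),
      infDist_hyperplane h.1]
  constructor
  · intro h a y ha
    rw [← key a y ha]
    exact h _ (isOpenSupportingHalfSpace_iff.2 ⟨a, y, ha, rfl⟩)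
  · intro h H hH
    obtain ⟨a, y, ha, rfl⟩ := isOpenSupportingHalfSpace_iff.1 hH
    rw [key a y ha, h a y ha]

theorem exists_dilationEquiv_image_eq (p : EuclideanSpace ℝ (Fin n)) {k : ℝ} (hk : k ≠ 0) :
    ∃ σ : EuclideanSpace ℝ (Fin n) ≃ᵈ EuclideanSpace ℝ (Fin n),
      ∀ X, σ '' X = {z | p + k⁻¹ • (z - p) ∈ X} := by
  let σ : EuclideanSpace ℝ (Fin n) ≃ᵈ EuclideanSpace ℝ (Fin n) :=
    (IsometryEquiv.subRight p).toDilationEquiv.trans (DilationEquiv.smulTorsor p hk)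
  have hσ : ∀ x, σ x = k • (x - p) + p := fun x => rfl
  refine ⟨σ, fun X => ?_⟩
  ext z
  constructor
  · rintro ⟨x, hx, rfl⟩
    rw [mem_ofPred_eq, hσ, add_sub_cancel_right, inv_smul_smul₀ hk, add_sub_cancel]
    exact hx
  · intro hz
    refine ⟨_, hz, ?_⟩
    rw [hσ, add_sub_cancel_left, smul_inv_smul₀ hk, sub_add_cancel]

theorem resilientToExpansion_of_isOuterNormal {X : Set (EuclideanSpace ℝ (Fin n))} (ho : IsOpen X)
    (hX : Convex ℝ X) (hne : X.Nonempty) {r S : ℝ} (hr : 0 < r) (hS : 0 < S)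
    {q : EuclideanSpace ℝ (Fin n)} (h : ∀ a y, IsOuterNormal X a y → ⟪a, y⟫ - ⟪a, q⟫ = S) :
    ResilientToExpansion r X := by
  have hk : 0 < 1 + r / S := by positivity
  have hkS : (1 + r / S) * S = S + r := by field_simp
  obtain ⟨σ, hσ⟩ := exists_dilationEquiv_image_eq q hk.ne'
  refine ⟨σ, ?_⟩
  rw [hσ, setExpansion_eq_thickening]
  ext z
  set w := q + (1 + r / S)⁻¹ • (z - q) with hw
  have hzw : ∀ a, ⟪a, z⟫ - ⟪a, q⟫ = (1 + r / S) * (⟪a, w⟫ - ⟪a, q⟫) := fun a => by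
    rw [hw, inner_add_right, add_sub_cancel_left, inner_smul_right, mul_inv_cancel_left₀ hk.ne',
      inner_sub_right]
  constructor
  · intro hz
    obtain ⟨x, hx, hxz⟩ := mem_thickening_iff.1 hz
    change w ∈ X
    by_contra hwX
    obtain ⟨a, y, ha, hay⟩ := exists_isOuterNormal_of_notMem hX ho hne hwX
    have h1 := h a y ha
    have h2 := ha.inner_lt ho hx
    have h3 := real_inner_le_norm a (z - x)
    rw [ha.1, one_mul, inner_sub_right, ← dist_eq_norm] at h3
    have h4 : (1 + r / S) * S ≤ (1 + r / S) * (⟪a, w⟫ - ⟪a, q⟫) :=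
      mul_le_mul_of_nonneg_left (by linarith) hk.le
    rw [hkS, ← hzw] at h4
    linarith
  · intro hwX
    change w ∈ X at hwX
    by_contra hz
    -- Passing to the closure lets the projection of z serve as a competitor, so z is at distance at
    -- least r from it.
    rw [← thickening_closure, mem_thickening_iff] at hz
    push Not at hz
    have hzc : z ∉ closure X := fun hc => by
      have := hz z hc
      rw [dist_self] at this
      linarith
    obtain ⟨π, hπ⟩ := exists_projection hne hX
    have hn := isOuterNormal_of_projection hπ hzc
    have hd := hz _ (hπ z).1
    set a := ‖z - π z‖⁻¹ • (z - π z) with ha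
    have h1 := h _ _ hn
    have h2 := hn.inner_lt ho hwX
    have hz0 : ‖z - π z‖ ≠ 0 := fun h0 => hzc (sub_eq_zero.1 (norm_eq_zero.1 h0) ▸ (hπ z).1)
    have h3 : ⟪a, z - π z⟫ = dist z (π z) := by
      rw [ha, real_inner_smul_left, real_inner_self_eq_norm_sq, pow_two, inv_mul_cancel_left₀ hz0,
        dist_eq_norm]
    rw [inner_sub_right] at h3
    have h4 : (1 + r / S) * (⟪a, w⟫ - ⟪a, q⟫) < (1 + r / S) * S :=
      mul_lt_mul_of_pos_left (by linarith) hk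
    rw [hkS, ← hzw] at h4
    linarith

theorem innerBoundedBy_setExpansion_iff {X : Set (EuclideanSpace ℝ (Fin n))} {r : ℝ} (hr : 0 < r)
    {p a : EuclideanSpace ℝ (Fin n)} (ha : ‖a‖ = 1) {s : ℝ} :
    InnerBoundedBy (setExpansion r X) p a s ↔ InnerBoundedBy X p a (s - r) := by
  rw [setExpansion_eq_thickening]
  constructor
  · intro h x hx
    by_contra! hlt
    -- The balls are open, so the step along a must be strictly shorter than r yet long enough to
    -- exceed s.
    have h0 : 0 ≤ max 0 (s - ⟪a, x - p⟫) := le_max_left _ _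
    obtain ⟨ε, hε1, hε2⟩ := exists_between (show max 0 (s - ⟪a, x - p⟫) < r by
      rw [max_lt_iff]; exact ⟨hr, by linarith⟩)
    have h1 := h (x + ε • a) (mem_thickening_iff.2 ⟨x, hx, by
      rwa [dist_eq_norm, add_sub_cancel_left, norm_smul, ha, mul_one, Real.norm_eq_abs,
        abs_of_nonneg (h0.trans hε1.le)]⟩)
    rw [add_sub_right_comm, inner_add_right, inner_smul_right, real_inner_self_eq_norm_sq, ha] at h1
    linarith [le_max_right 0 (s - ⟪a, x - p⟫)]
  · intro h z hz
    obtain ⟨x, hx, hxz⟩ := mem_thickening_iff.1 hz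
    have h1 := h x hx
    have h2 := real_inner_le_norm a (z - x)
    rw [ha, one_mul, ← dist_eq_norm] at h2
    have h3 : ⟪a, z - p⟫ = ⟪a, z - x⟫ + ⟪a, x - p⟫ := by rw [← inner_add_right, sub_add_sub_cancel]
    linarith

theorem exists_supportsAtDistance_of_resilientToExpansion {X : Set (EuclideanSpace ℝ (Fin n))}
    (hne : X.Nonempty) {r : ℝ} (hr : 0 < r) (h : ResilientToExpansion r X) :
    ∃ R : ℝ, 0 < R ∧ ∃ p, SupportsAtDistance X p R := by
  obtain ⟨x₀, hx₀⟩ := hne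
  obtain ⟨σ, hσX⟩ := h
  obtain ⟨c, U, p, b, hc, hσ, hUb, hcb⟩ := σ.exists_normal_form
  -- The functional equation of the support function, stated through bounds so that infinite values
  -- need no separate treatment.
  have key : ∀ a s, ‖a‖ = 1 →
      (InnerBoundedBy X p a s ↔ InnerBoundedBy X p (U.symm a) ((s + r - ⟪a, b⟫) / c)) := by
    intro a s ha
    have h1 := innerBoundedBy_setExpansion_iff hr ha (X := X) (p := p) (s := s + r)
    rw [add_sub_cancel_right] at h1
    rw [← h1, hσX]
    have h2 : ∀ x, ⟪a, σ x - p⟫ = ⟪U.symm a, x - p⟫ * c + ⟪a, b⟫ := fun x => by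
      have h3 := U.inner_map_map (U.symm a) (x - p)
      rw [U.apply_symm_apply] at h3
      rw [hσ, add_assoc, add_sub_cancel_left, inner_add_right, inner_smul_right, h3, mul_comm]
    unfold InnerBoundedBy
    rw [forall_mem_image]
    refine forall₂_congr fun x _ => ?_
    rw [h2, le_div_iff₀ hc, le_sub_iff_add_le]
  rcases eq_or_ne c 1 with rfl | hc1
  · have hsb : U.symm b = b := by rw [LinearIsometryEquiv.symm_apply_eq, hUb]
    have hb : ∀ a s, ‖a‖ = 1 → InnerBoundedBy X p a s → ⟪a, b⟫ = r := fun a s ha hs =>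
      hs.inner_eq_of_translating hx₀ U.symm hsb (fun a s ha => by rw [key a s ha, div_one]) ha
    obtain ⟨R, q, hR, hq⟩ := exists_forall_isOuterNormal_of_unique (X := X)
      fun a y a' y' ha ha' => InnerBoundedBy.unique_of_inner_eq hr hb ha.1 (ha.innerBoundedBy p)
        ha'.1 (ha'.innerBoundedBy p)
    refine ⟨R, hR, q, supportsAtDistance_iff.2 fun a y ha => ?_⟩
    rw [abs_sub_comm, hq a y ha, abs_of_pos hR]
  · obtain rfl : b = 0 := hcb.resolve_left hc1
    simp only [inner_zero_right, sub_zero] at key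
    have hc1' : c - 1 ≠ 0 := sub_ne_zero.2 hc1
    -- The value r / (c - 1) is the fixed point of s ↦ (s + r) / c. It is negative for c < 1, when p
    -- lies outside the supporting half-spaces; hence the absolute value below.
    have hmain : ∀ a s, ‖a‖ = 1 → InnerBoundedBy X p a s →
        r / (c - 1) ≤ s ∧ InnerBoundedBy X p a (r / (c - 1)) := by
      have hk : ∀ a g, ‖a‖ = 1 → (InnerBoundedBy X p a (r / (c - 1) + g) ↔
          InnerBoundedBy X p (U.symm a) (r / (c - 1) + g / c)) := fun a g ha => by
        rw [key a _ ha]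
        have : (r / (c - 1) + g + r) / c = r / (c - 1) + g / c := by field_simp; ring
        rw [this]
      intro a s ha hs
      rcases lt_or_gt_of_ne hc1 with hlt | hlt
      · refine hs.le_and_innerBoundedBy_of_scaling hx₀ U ((one_lt_inv₀ hc).2 hlt) (fun a g ha => ?_) ha
        have := hk (U a) (g * c) (by rw [U.norm_map, ha])
        rw [U.symm_apply_apply, mul_div_cancel_right₀ _ hc.ne'] at this
        rw [← this, div_inv_eq_mul]
      · exact hs.le_and_innerBoundedBy_of_scaling hx₀ U.symm hlt hk ha
    refine ⟨|r / (c - 1)|, abs_pos.2 (div_ne_zero hr.ne' hc1'), p,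
      supportsAtDistance_iff.2 fun a y ha => ?_⟩
    obtain ⟨h1, h2⟩ := hmain a _ ha.1 (ha.innerBoundedBy p)
    have h3 : ⟪a, y⟫ ≤ r / (c - 1) + ⟪a, p⟫ := inner_le_of_mem_closure (fun x hx => by
      have := h2 x hx
      rw [inner_sub_right] at this
      linarith) y ha.2.1
    rw [abs_sub_comm, le_antisymm (show ⟪a, y⟫ - ⟪a, p⟫ ≤ r / (c - 1) by linarith) h1]

theorem resilientToExpansion_iff {X : Set (EuclideanSpace ℝ (Fin n))} (ho : IsOpen X)
    (hX : Convex ℝ X) {r : ℝ} (hr : 0 < r) :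
    ResilientToExpansion r X ↔ ∃ R : ℝ, 0 < R ∧ ∃ p, SupportsAtDistance X p R := by
  rcases X.eq_empty_or_nonempty with rfl | hne
  · refine iff_of_true ⟨DilationEquiv.refl _, by simp [setExpansion]⟩
      ⟨1, one_pos, 0, supportsAtDistance_iff.2 fun a y ha => ?_⟩
    simpa using ha.2.1
  · refine ⟨exists_supportsAtDistance_of_resilientToExpansion hne hr, ?_⟩
    rintro ⟨R, hR, p, h⟩
    obtain ⟨S, q, hS, hq⟩ :=
      exists_forall_isOuterNormal_inner_sub_eq hX ho hne hR (supportsAtDistance_iff.1 h)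
    exact resilientToExpansion_of_isOuterNormal ho hX hne hr hS hq

/-! ### Bounded sets -/

theorem resilientToExpansion_ball (p : EuclideanSpace ℝ (Fin n)) {ρ r : ℝ} (hρ : 0 < ρ)
    (hr : 0 < r) : ResilientToExpansion r (ball p ρ) := by
  have hk : 0 < 1 + r / ρ := by positivity
  obtain ⟨σ, hσ⟩ := exists_dilationEquiv_image_eq p hk.ne'
  refine ⟨σ, ?_⟩
  rw [hσ, setExpansion_eq_thickening, thickening_ball hr hρ]
  ext z
  rw [mem_ofPred_eq, mem_ball, mem_ball, dist_eq_norm, dist_eq_norm, add_sub_cancel_left, norm_smul,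
    Real.norm_eq_abs, abs_of_pos (inv_pos.2 hk), inv_mul_lt_iff₀ hk, add_mul, one_mul,
    div_mul_cancel₀ _ hρ.ne', add_comm]

theorem ball_subset_of_ball_subset {X : Set (EuclideanSpace ℝ (Fin n))} {r : ℝ} (hr : 0 < r)
    {σ : EuclideanSpace ℝ (Fin n) ≃ᵈ EuclideanSpace ℝ (Fin n)} (h : setExpansion r X = σ '' X)
    {c : ℝ} (hc : 0 < c) (hσ : ∀ x y, dist (σ x) (σ y) = c * dist x y)
    {q : EuclideanSpace ℝ (Fin n)} {s : ℝ} (hs : 0 < s) (hq : ball q s ⊆ X) :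
    ball (σ.symm q) ((s + r) / c) ⊆ X := by
  intro z hz
  have h1 : σ z ∈ thickening r (ball q s) := by
    rw [thickening_ball hr hs, mem_ball]
    have := hσ z (σ.symm q)
    rw [σ.apply_symm_apply] at this
    rw [mem_ball, lt_div_iff₀ hc] at hz
    linarith
  have h2 : σ z ∈ σ '' X := by
    rw [← h, setExpansion_eq_thickening]
    exact thickening_subset_of_subset r hq h1
  exact (σ.injective.mem_set_image).1 h2

/-- If c ≤ 1, each pullback by σ enlarges an inscribed ball's radius by at least r. Nontriviality
makes large balls have large diameter. -/
theorem one_lt_of_setExpansion_eq_image {X : Set (EuclideanSpace ℝ (Fin n))}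
    [Nontrivial (EuclideanSpace ℝ (Fin n))] (hb : Bornology.IsBounded X) (ho : IsOpen X)
    (hne : X.Nonempty) {r : ℝ} (hr : 0 < r)
    {σ : EuclideanSpace ℝ (Fin n) ≃ᵈ EuclideanSpace ℝ (Fin n)} (h : setExpansion r X = σ '' X)
    {c : ℝ} (hc : 0 < c) (hσ : ∀ x y, dist (σ x) (σ y) = c * dist x y) : 1 < c := by
  by_contra! hc1
  have hk : ∀ k : ℕ, ∃ q s, 0 < s ∧ k * r ≤ s ∧ ball q s ⊆ X := fun k => by
    induction k with
    | zero =>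
      obtain ⟨x, hx⟩ := hne
      obtain ⟨s, hs, hsub⟩ := Metric.isOpen_iff.1 ho x hx
      exact ⟨x, s, hs, by simpa using hs.le, hsub⟩
    | succ k ih =>
      obtain ⟨q, s, hs, hks, hsub⟩ := ih
      refine ⟨_, _, by positivity, ?_, ball_subset_of_ball_subset hr h hc hσ hs hsub⟩
      have : s + r ≤ (s + r) / c := le_div_self (by positivity) hc hc1
      push_cast
      linarith
  obtain ⟨M, hM⟩ := (isBounded_iff_subset_ball (0 : EuclideanSpace ℝ (Fin n))).1 hb
  obtain ⟨k, hkM⟩ := exists_nat_gt (2 * M / r)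
  rw [div_lt_iff₀ hr] at hkM
  obtain ⟨q, s, hs, hks, hsub⟩ := hk k
  obtain ⟨u, hu⟩ := exists_norm_eq (EuclideanSpace ℝ (Fin n)) (show 0 ≤ s / 2 by positivity)
  have h1 : q + u ∈ ball (0 : EuclideanSpace ℝ (Fin n)) M := hM (hsub (by
    rw [mem_ball, dist_eq_norm, add_sub_cancel_left, hu]; linarith))
  have h2 : q - u ∈ ball (0 : EuclideanSpace ℝ (Fin n)) M := hM (hsub (by
    rw [mem_ball, dist_eq_norm, sub_sub_cancel_left, norm_neg, hu]; linarith))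
  rw [mem_ball_zero_iff] at h1 h2
  have h3 := norm_sub_le (q + u) (q - u)
  have h4 : q + u - (q - u) = (2 : ℝ) • u := by rw [two_smul]; abel
  rw [h4, norm_smul, hu, Real.norm_ofNat] at h3
  linarith

theorem eq_ball_of_resilientToExpansion {X : Set (EuclideanSpace ℝ (Fin n))}
    (hb : Bornology.IsBounded X) (hne : X.Nonempty) {r : ℝ} (hr : 0 < r)
    (h : ResilientToExpansion r X) : ∃ p ρ, 0 < ρ ∧ X = ball p ρ := by
  rcases subsingleton_or_nontrivial (EuclideanSpace ℝ (Fin n)) with hsub | hnt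
  · refine ⟨0, 1, one_pos, ?_⟩
    rw [Subsingleton.eq_univ_of_nonempty hne,
      Subsingleton.eq_univ_of_nonempty (nonempty_ball.2 one_pos)]
  obtain ⟨σ, h⟩ := h
  obtain ⟨c, U, p, b, hc, hform, -, hcb⟩ := σ.exists_normal_form
  have hσ : ∀ x y, dist (σ x) (σ y) = c * dist x y := fun x y => by
    rw [hform, hform, dist_add_right, dist_add_left, dist_smul₀, U.dist_map, dist_sub_right,
      Real.norm_eq_abs, abs_of_pos hc]
  have ho : IsOpen X := by
    have : IsOpen (σ '' X) := by
      rw [← h, setExpansion_eq_thickening]; exact isOpen_thickening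
    exact σ.toHomeomorph.isOpen_image.1 this
  have hc1 := one_lt_of_setExpansion_eq_image hb ho hne hr h hc hσ
  obtain rfl : b = 0 := hcb.resolve_left hc1.ne'
  have hp : σ p = p := by simp [hform]
  have hp' : σ.symm p = p := by rw [DilationEquiv.symm_apply_eq, hp]
  have hc1' : c - 1 ≠ 0 := (sub_pos.2 hc1).ne'
  set R := r / (c - 1) with hR
  have hRpos : 0 < R := div_pos hr (sub_pos.2 hc1)
  have hstep : ∀ g, (R + g + r) / c = R + g / c := fun g => by rw [hR]; field_simp; ring
  have hlim : ∀ g : ℝ, Tendsto (fun k : ℕ => g / c ^ k) atTop (𝓝 0) := fun g =>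
    tendsto_const_nhds.div_atTop (tendsto_pow_atTop_atTop_of_one_lt hc1)
  refine ⟨p, R, hRpos, Subset.antisymm ?_ ?_⟩
  · obtain ⟨M, hM⟩ := (isBounded_iff_subset_closedBall p).1 hb
    -- A bound m on distances to p improves to (m + r) / c, whose iterates tend to R. The limit
    -- gives only the closed ball; openness of X removes the sphere.
    have hk : ∀ k : ℕ, ∀ x ∈ X, dist x p ≤ R + (M - R) / c ^ k := fun k => by
      induction k with
      | zero => intro x hx; simpa using hM hx
      | succ k ih =>
        intro x hx
        have h1 : σ x ∈ thickening r X := by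
          rw [← setExpansion_eq_thickening, h]; exact mem_image_of_mem σ hx
        obtain ⟨y, hy, hxy⟩ := mem_thickening_iff.1 h1
        have h2 := hσ x p
        rw [hp] at h2
        rw [pow_succ, ← div_div, ← hstep, le_div_iff₀ hc]
        linarith [dist_triangle (σ x) y p, ih y hy]
    rw [← interior_closedBall p hRpos.ne']
    refine interior_maximal (fun x hx => ?_) ho
    have := (tendsto_const_nhds (x := R)).add (hlim (M - R))
    rw [add_zero] at this
    exact ge_of_tendsto' this fun k => hk k x hx
  · obtain ⟨x, hx⟩ := hne
    obtain ⟨s, hs, hsub⟩ := Metric.isOpen_iff.1 ho x hx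
    -- Under pullback by σ, inscribed balls have centres tending to p and radii tending to R, so
    -- they eventually contain any given point of the open ball.
    have hk : ∀ k : ℕ, ∃ q, dist q p = dist x p / c ^ k ∧ 0 < R + (s - R) / c ^ k ∧
        ball q (R + (s - R) / c ^ k) ⊆ X := fun k => by
      induction k with
      | zero => exact ⟨x, by simp, by simpa using hs, by simpa using hsub⟩
      | succ k ih =>
        obtain ⟨q, h1, h2, h3⟩ := ih
        rw [pow_succ, ← div_div, ← div_div, ← hstep]
        refine ⟨σ.symm q, ?_, by positivity, ball_subset_of_ball_subset hr h hc hσ h2 h3⟩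
        have h4 := hσ (σ.symm q) p
        rw [σ.apply_symm_apply, hp] at h4
        rw [← h1, h4, mul_div_cancel_left₀ _ hc.ne']
    intro z hz
    have h1 : Tendsto (fun k : ℕ => R + (s - R) / c ^ k - dist x p / c ^ k) atTop
        (𝓝 (R + 0 - 0)) := (tendsto_const_nhds.add (hlim _)).sub (hlim _)
    rw [add_zero, sub_zero] at h1
    obtain ⟨k, hk1⟩ := (h1.eventually_const_lt (mem_ball.1 hz)).exists
    obtain ⟨q, h2, -, h3⟩ := hk k
    refine h3 ?_
    rw [mem_ball]
    have := dist_triangle_right z q p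
    linarith

end Expansion

theorem mainTheorem6 (n : ℕ) :
    (∀ X : Set (EuclideanSpace ℝ (Fin n)), IsOpen X → Convex ℝ X →
      ((∃ r : ℝ, 0 < r ∧ ResilientToExpansion r X) ↔
        ∃ r : ℝ, 0 < r ∧ ∃ R : ℝ, r < R ∧
          ∃ p : EuclideanSpace ℝ (Fin n), SupportsAtDistance X p R) ∧
      (∀ r : ℝ, 0 < r →
        (ResilientToExpansion r X ↔
          ∃ R : ℝ, 0 < R ∧ ∃ p : EuclideanSpace ℝ (Fin n), SupportsAtDistance X p R))) ∧
    (∀ X : Set (EuclideanSpace ℝ (Fin n)), Bornology.IsBounded X → X.Nonempty →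
      ((∃ r : ℝ, 0 < r ∧ ResilientToExpansion r X) ↔
        ∃ (p : EuclideanSpace ℝ (Fin n)) (ρ : ℝ), 0 < ρ ∧ X = Metric.ball p ρ)) := by
  refine ⟨fun X ho hX => ⟨⟨?_, ?_⟩, fun r hr => resilientToExpansion_iff ho hX hr⟩,
    fun X hb hne => ⟨?_, ?_⟩⟩
  · rintro ⟨r, hr, h⟩
    obtain ⟨R, hR, p, hp⟩ := (resilientToExpansion_iff ho hX hr).1 h
    -- Any radius in (0, R) would do: resilience does not depend on the radius.
    exact ⟨R / 2, half_pos hR, R, half_lt_self hR, p, hp⟩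
  · rintro ⟨r, hr, R, hrR, p, hp⟩
    exact ⟨r, hr, (resilientToExpansion_iff ho hX hr).2 ⟨R, hr.trans hrR, p, hp⟩⟩
  · rintro ⟨r, hr, h⟩
    exact eq_ball_of_resilientToExpansion hb hne hr h
  · rintro ⟨p, ρ, hρ, rfl⟩
    exact ⟨1, one_pos, resilientToExpansion_ball p hρ one_pos⟩
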